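/- Let $k$ be an algebraically closed field of characteristic $2$, let $q$ be a power of an odd prime, and let $H$ be one of the groups $\mathrm{PSL}_2(q)$ or $\mathrm{PGL}_2(q)$. Assume that the Sylow $2$-subgroups of $H$ are dihedral of order at least $8$. Let $C_f\leq\mathrm{Aut}(\mathbb F_q)$ be a (cyclic) group of field automorphisms of odd order $f\ge 1$, acting on $H$ through its action on matrix entries, and let $G=H\rtimes C_f$. Then the principal blocks $B_0(kG)$ and $B_0(kH)$ are splendidly Morita equivalent. Here the principal block $B_0(kX)$ of a finite group $X$ is the block algebra $e\,kX$, where $e$ is the primitive idempotent of the centre of $kX$ which acts as the identity on the trivial $kX$-module. Two block algebras $A$ of $kG$ and $B$ of $kH$ are splendidly Morita equivalent if there are a finitely generated $(A,B)$-bimodule $M$ and a finitely generated $(B,A)$-bimodule $N$ such that $M\otimes_B N\cong A$ and $N\otimes_A M\cong B$ as bimodules (that is, $M$ induces a Morita equivalence between $A$ and $B$), and $M$, seen as a $k[G\times H]$-module via $(g,h)\cdot m=gmh^{-1}$, is a $2$-permutation module, i.e. a direct summand of a finitely generated permutation module. -/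

import Mathlib

open scoped TensorProduct MatrixGroups MonoidAlgebra

universe u v w x

noncomputable section

/-! ### Bimodules over (noncommutative) algebras -/

/-- An `(A, B)`-bimodule over `k`: a `k`-module with commuting `k`-linear actions of `A` on the left
and of `B` on the right (a right action of `B` is a left action of `Bᵐᵒᵖ`). -/
structure Bimodule (k : Type u) [CommRing k] (A : Type v) [Ring A] [Algebra k A]
    (B : Type w) [Ring B] [Algebra k B] where
  carrier : Type x
  [addCommGroup : AddCommGroup carrier]
  [module : Module k carrier]
  left : A →ₐ[k] Module.End k carrier
  right : Bᵐᵒᵖ →ₐ[k] Module.End k carrier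
  comm : ∀ a b, Commute (left a) (right b)

namespace Bimodule

attribute [instance] Bimodule.addCommGroup Bimodule.module

variable {k : Type u} [CommRing k] {A B C : Type*} [Ring A] [Algebra k A] [Ring B] [Algebra k B]
  [Ring C] [Algebra k C]

/-- The algebra `A` as an `(A, A)`-bimodule, by left and right multiplication. -/
abbrev regular (k : Type u) [CommRing k] (A : Type v) [Ring A] [Algebra k A] :
    Bimodule.{u, v, v, v} k A A where
  carrier := A
  left := Algebra.lsmul k k A
  right := Algebra.lsmul k k A
  comm a b := LinearMap.ext fun m => (mul_assoc a m b.unop).symm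

/-- Isomorphism of bimodules: a `k`-linear bijection commuting with both actions. -/
def Iso (M : Bimodule k A B) (N : Bimodule k A B) : Prop :=
  ∃ φ : M.carrier ≃ₗ[k] N.carrier,
    (∀ a m, φ (M.left a m) = N.left a (φ m)) ∧ (∀ b m, φ (M.right b m) = N.right b (φ m))

/-- The relations `m b ⊗ n = m ⊗ b n` defining `M ⊗_B N` as a quotient of `M ⊗_k N`. -/
def tensorRel (M : Bimodule k A B) (N : Bimodule k B C) :
    Submodule k (M.carrier ⊗[k] N.carrier) :=
  Submodule.span k {t | ∃ (m : M.carrier) (b : B) (n : N.carrier),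
    t = (M.right (MulOpposite.op b) m) ⊗ₜ[k] n - m ⊗ₜ[k] (N.left b n)}

theorem tensorRel_le_left (M : Bimodule k A B) (N : Bimodule k B C) (a : A) :
    tensorRel M N ≤ (tensorRel M N).comap ((M.left a).rTensor N.carrier) := by
  refine Submodule.span_le.2 ?_
  rintro _ ⟨m, b, n, rfl⟩
  refine Submodule.subset_span ⟨M.left a m, b, n, ?_⟩
  have h := LinearMap.congr_fun (M.comm a (MulOpposite.op b)).eq m
  simp only [Module.End.mul_apply] at h
  simp [h]

theorem tensorRel_le_right (M : Bimodule k A B) (N : Bimodule k B C) (c : Cᵐᵒᵖ) :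
    tensorRel M N ≤ (tensorRel M N).comap ((N.right c).lTensor M.carrier) := by
  refine Submodule.span_le.2 ?_
  rintro _ ⟨m, b, n, rfl⟩
  refine Submodule.subset_span ⟨m, b, N.right c n, ?_⟩
  have h := LinearMap.congr_fun (N.comm b c).eq n
  simp only [Module.End.mul_apply] at h
  simp [h]

/-- The tensor product `M ⊗_B N` of an `(A, B)`-bimodule and a `(B, C)`-bimodule, as an
`(A, C)`-bimodule: `a (m ⊗ n) c = a m ⊗ n c`. -/
def tensor (M : Bimodule k A B) (N : Bimodule k B C) : Bimodule k A C where
  carrier := (M.carrier ⊗[k] N.carrier) ⧸ tensorRel M N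
  left := AlgHom.ofLinearMap
    { toFun := fun a => (tensorRel M N).mapQ (tensorRel M N) ((M.left a).rTensor N.carrier)
        (tensorRel_le_left M N a)
      map_add' := fun a b => by
        refine Submodule.linearMap_qext _ (TensorProduct.ext' fun m n => ?_)
        simp
      map_smul' := fun r a => by
        refine Submodule.linearMap_qext _ (TensorProduct.ext' fun m n => ?_)
        simp only [LinearMap.coe_comp, Function.comp_apply, Submodule.mkQ_apply, Submodule.mapQ_apply,
          LinearMap.rTensor_tmul, map_smul, LinearMap.smul_apply, RingHom.id_apply,
          ← TensorProduct.smul_tmul', Submodule.Quotient.mk_smul] }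
    (by
      refine Submodule.linearMap_qext _ (TensorProduct.ext' fun m n => ?_)
      simp)
    (fun a b => by
      refine Submodule.linearMap_qext _ (TensorProduct.ext' fun m n => ?_)
      simp)
  right := AlgHom.ofLinearMap
    { toFun := fun c => (tensorRel M N).mapQ (tensorRel M N) ((N.right c).lTensor M.carrier)
        (tensorRel_le_right M N c)
      map_add' := fun a b => by
        refine Submodule.linearMap_qext _ (TensorProduct.ext' fun m n => ?_)
        simp
      map_smul' := fun r a => by
        refine Submodule.linearMap_qext _ (TensorProduct.ext' fun m n => ?_)
        simp }
    (by
      refine Submodule.linearMap_qext _ (TensorProduct.ext' fun m n => ?_)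
      simp)
    (fun a b => by
      refine Submodule.linearMap_qext _ (TensorProduct.ext' fun m n => ?_)
      simp)
  comm a c := by
    refine Submodule.linearMap_qext _ (TensorProduct.ext' fun m n => ?_)
    simp

/-- The `(A, B)`-bimodule `M` induces a Morita equivalence between `A` and `B`: it is finitely
generated and invertible, i.e. there is a (finitely generated) `(B, A)`-bimodule `N` with
`M ⊗_B N ≅ A` and `N ⊗_A M ≅ B` as bimodules. -/
def InducesMoritaEquivalence (M : Bimodule.{_, _, _, x} k A B) : Prop :=
  Module.Finite k M.carrier ∧
  ∃ N : Bimodule.{_, _, _, x} k B A, Module.Finite k N.carrier ∧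
    (M.tensor N).Iso (regular k A) ∧ (N.tensor M).Iso (regular k B)

end Bimodule

/-! ### Blocks of group algebras -/

section Blocks

variable {k : Type u} [Field k] {G : Type v} [Group G] {H : Type w} [Group H]

/-- A block idempotent of `kG`: a primitive idempotent of the centre of `kG`. -/
structure IsBlockIdempotent (e : k[G]) : Prop where
  idem : IsIdempotentElem e
  central : e ∈ Subalgebra.center k k[G]
  ne_zero : e ≠ 0
  primitive : ∀ f ∈ Subalgebra.center k k[G], IsIdempotentElem f → e * f = f → f = 0 ∨ f = e

/-- The augmentation `kG → k`, i.e. the action of `kG` on the trivial module. -/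
def groupAugmentation (k : Type u) [Field k] (G : Type v) [Group G] : k[G] →ₐ[k] k :=
  MonoidAlgebra.lift k k G 1

/-- The principal block idempotent: the block idempotent acting as the identity on the trivial
module. -/
structure IsPrincipalBlockIdempotent (e : k[G]) : Prop extends IsBlockIdempotent e where
  augmentation : groupAugmentation k G e = 1

theorem IsPrincipalBlockIdempotent.unique {e f : k[G]} (he : IsPrincipalBlockIdempotent e)
    (hf : IsPrincipalBlockIdempotent f) : e = f := by
  have hc : e * f = f * e := Subalgebra.mem_center_iff.1 hf.central e
  have hmem : e * f ∈ Subalgebra.center k k[G] := mul_mem he.central hf.central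
  have hidem : IsIdempotentElem (e * f) := he.idem.mul_of_commute hc hf.idem
  have hne : e * f ≠ 0 := fun h => by
    have := congrArg (groupAugmentation k G) h
    simp [he.augmentation, hf.augmentation] at this
  have h1 := (he.primitive _ hmem hidem (by rw [← mul_assoc, he.idem.eq])).resolve_left hne
  have h2 := (hf.primitive _ hmem hidem
    (by rw [hc, ← mul_assoc, hf.idem.eq])).resolve_left hne
  exact h1.symm.trans h2

theorem exists_isPrincipalBlockIdempotent (k : Type u) [Field k] (G : Type v) [Group G]
    [Finite G] : ∃ e : k[G], IsPrincipalBlockIdempotent e := by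
  classical
  have : Module.Finite k k[G] :=
    Module.Finite.equiv (MonoidAlgebra.coeffLinearEquiv k (S := k) (M := G)).symm
  let S : Set k[G] := {e | IsIdempotentElem e ∧ e ∈ Subalgebra.center k k[G] ∧
    groupAugmentation k G e = 1}
  have hS : S.Nonempty := ⟨1, IsIdempotentElem.one, one_mem _, map_one _⟩
  let r : k[G] → ℕ := fun e => Module.finrank k (LinearMap.range (LinearMap.mulLeft k e))
  obtain ⟨e, ⟨hei, hec, hea⟩, hmin⟩ := exists_minimalFor_of_wellFoundedLT (· ∈ S) r hS
  have key : ∀ f ∈ Subalgebra.center k k[G], IsIdempotentElem f → e * f = f →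
      groupAugmentation k G f = 1 → f = e := by
    intro f hfc hfi hef hfa
    have hle : LinearMap.range (LinearMap.mulLeft k f) ≤ LinearMap.range (LinearMap.mulLeft k e) := by
      rintro _ ⟨y, rfl⟩
      exact ⟨f * y, by simp [← mul_assoc, hef]⟩
    have hrank : r f ≤ r e := Submodule.finrank_mono hle
    have heq := Submodule.eq_of_le_of_finrank_le hle (hmin ⟨hfi, hfc, hfa⟩ hrank)
    have : e ∈ LinearMap.range (LinearMap.mulLeft k f) := by
      rw [heq]; exact ⟨1, by simp⟩
    obtain ⟨y, hy⟩ := this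
    have hy' : f * y = e := hy
    have : f * e = e := by rw [← hy', ← mul_assoc, hfi.eq]
    rw [← this, ← Subalgebra.mem_center_iff.1 hfc e, hef]
  refine ⟨e, ⟨⟨hei, hec, ?_, ?_⟩, hea⟩⟩
  · rintro rfl
    simp at hea
  · intro f hfc hfi hef
    have h01 : groupAugmentation k G f = 0 ∨ groupAugmentation k G f = 1 :=
      IsIdempotentElem.iff_eq_zero_or_one.1 (hfi.map (groupAugmentation k G))
    rcases h01 with h | h
    · left
      have hfe : f * e = f := by rw [← Subalgebra.mem_center_iff.1 hfc e, hef]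
      have h' := key (e - f) (sub_mem hec hfc)
        (by
          change (e - f) * (e - f) = e - f
          rw [sub_mul, mul_sub, mul_sub, hei.eq, hfi.eq, hef, hfe]; abel)
        (by rw [mul_sub, hei.eq, hef]) (by rw [map_sub, hea, h, sub_zero])
      simpa using h'
    · right
      exact key f hfc hfi hef h

/-- The idempotent of the principal block of `kG`. -/
def principalBlockIdempotent (k : Type u) [Field k] (G : Type v) [Group G] [Finite G] : k[G] :=
  (exists_isPrincipalBlockIdempotent k G).choose

theorem principalBlockIdempotent_spec (k : Type u) [Field k] (G : Type v) [Group G] [Finite G] :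
    IsPrincipalBlockIdempotent (principalBlockIdempotent k G) :=
  (exists_isPrincipalBlockIdempotent k G).choose_spec

/-- The corner `e R e` of a `k`-algebra at an idempotent is a `k`-algebra (with identity `e`). -/
instance cornerAlgebra {R : Type*} [Ring R] [Algebra k R] {e : R} (he : IsIdempotentElem e) :
    Algebra k he.Corner where
  smul r y := ⟨r • y.1, (Subsemigroup.mem_corner_iff he).2 (by
    have := (Subsemigroup.mem_corner_iff he).1 y.2
    rw [mul_smul_comm, smul_mul_assoc, this.1, this.2]
    exact ⟨rfl, rfl⟩)⟩
  algebraMap :=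
    { toFun := fun r => ⟨r • e, (Subsemigroup.mem_corner_iff he).2 (by
        rw [mul_smul_comm, smul_mul_assoc, he.eq]; exact ⟨rfl, rfl⟩)⟩
      map_one' := Subtype.ext (one_smul k e)
      map_mul' := fun r s => Subtype.ext (by
        change (r * s) • e = (r • e) * (s • e)
        rw [smul_mul_smul_comm, he.eq])
      map_zero' := Subtype.ext (zero_smul k e)
      map_add' := fun r s => Subtype.ext (add_smul r s e) }
  commutes' r y := Subtype.ext (by
    have := (Subsemigroup.mem_corner_iff he).1 y.2
    change (r • e) * y.1 = y.1 * (r • e)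
    rw [mul_smul_comm, smul_mul_assoc, this.1, this.2])
  smul_def' r y := Subtype.ext (by
    have := (Subsemigroup.mem_corner_iff he).1 y.2
    change r • y.1 = (r • e) * y.1
    rw [smul_mul_assoc, this.1])

/-- The block algebra `e kG = e kG e` of a block idempotent `e`. -/
abbrev BlockAlgebra {e : k[G]} (he : IsBlockIdempotent e) : Type _ := he.idem.Corner

/-- The canonical map `G → e kG`, `g ↦ e g`, into a block algebra. -/
def toBlockAlgebra {e : k[G]} (he : IsBlockIdempotent e) : G →* BlockAlgebra he where
  toFun g := ⟨e * MonoidAlgebra.of k G g, by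
    have h := Subalgebra.mem_center_iff.1 he.central (MonoidAlgebra.of k G g)
    refine (Subsemigroup.mem_corner_iff he.idem).2 ⟨?_, ?_⟩
    · rw [← mul_assoc, he.idem.eq]
    · rw [mul_assoc, h, ← mul_assoc, he.idem.eq]⟩
  map_one' := Subtype.ext (by
    change e * MonoidAlgebra.of k G 1 = e
    rw [map_one, mul_one])
  map_mul' g h := Subtype.ext (by
    have hc := Subalgebra.mem_center_iff.1 he.central (MonoidAlgebra.of k G g)
    change e * MonoidAlgebra.of k G (g * h)
      = (e * MonoidAlgebra.of k G g) * (e * MonoidAlgebra.of k G h)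
    rw [map_mul, mul_assoc e, ← mul_assoc _ e, hc, mul_assoc e, ← mul_assoc e e, he.idem.eq])

/-- A bimodule over block algebras of `kG` and `kH`, seen as a representation of `G × H`:
`(g, h) · m = g m h⁻¹`. -/
def Bimodule.toRepresentation {e : k[G]} {f : k[H]} {he : IsBlockIdempotent e}
    {hf : IsBlockIdempotent f} (M : Bimodule k (BlockAlgebra he) (BlockAlgebra hf)) :
    Representation k (G × H) M.carrier where
  toFun p := M.left (toBlockAlgebra he p.1) * M.right (MulOpposite.op (toBlockAlgebra hf p.2⁻¹))
  map_one' := by simp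
  map_mul' p q := by
    have h := (M.comm (toBlockAlgebra he q.1)
      (MulOpposite.op (toBlockAlgebra hf p.2⁻¹))).eq
    simp only [Prod.fst_mul, Prod.snd_mul, mul_inv_rev, map_mul, MulOpposite.op_mul]
    simp only [mul_assoc]
    rw [← mul_assoc (M.right _) (M.left _), ← h]
    simp only [mul_assoc]

/-- `p`-permutation modules, where `p` is the characteristic of `k`: the direct summands of
finitely generated permutation modules `k[X]`, for `X` a finite `Γ`-set. -/
def Representation.IsPPermutation {Γ : Type v} [Group Γ] {V : Type w} [AddCommGroup V] [Module k V]
    (ρ : Representation k Γ V) : Prop :=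
  ∃ (X : Type v) (_ : MulAction Γ X) (_ : Finite X)
    (i : ρ.IntertwiningMap (Representation.ofMulAction k Γ X))
    (π : (Representation.ofMulAction k Γ X).IntertwiningMap ρ), ∀ m : V, π (i m) = m

/-- Splendid Morita equivalence (Puig equivalence) of block algebras of `kG` and `kH`: there is a
Morita equivalence between them induced by a bimodule which is a `p`-permutation module for
`G × H`. -/
def SplendidlyMoritaEquivalent {e : k[G]} {f : k[H]} (he : IsBlockIdempotent e)
    (hf : IsBlockIdempotent f) : Prop :=
  ∃ M : Bimodule.{u, max u v, max u w, max u v w} k (BlockAlgebra he) (BlockAlgebra hf),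
    M.InducesMoritaEquivalence ∧ M.toRepresentation.IsPPermutation

/-- The principal blocks `B₀(kG)` and `B₀(kH)` are splendidly Morita equivalent. -/
def PrincipalBlocksSplendidlyMoritaEquivalent (k : Type u) [Field k] (G : Type v) [Group G]
    [Finite G] (H : Type w) [Group H] [Finite H] : Prop :=
  SplendidlyMoritaEquivalent (principalBlockIdempotent_spec k G).toIsBlockIdempotent
    (principalBlockIdempotent_spec k H).toIsBlockIdempotent

end Blocks

/-! ### Groups with dihedral Sylow subgroups, and field automorphisms -/

/-- The Sylow `2`-subgroups of `G` are dihedral of order `2 ^ n` for some `n ≥ 3` (all Sylow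
`2`-subgroups being conjugate, it is enough to say this for one of them; `DihedralGroup m` has
order `2 * m`). -/
def HasDihedralSylowTwo (G : Type*) [Group G] : Prop :=
  ∃ (P : Sylow 2 G) (n : ℕ), 3 ≤ n ∧ Nonempty (P ≃* DihedralGroup (2 ^ (n - 1)))

section FieldAutomorphisms

variable (F : Type v) [Field F]

/-- The action of the automorphisms of `F` on `SL₂(F)`, entry by entry. -/
def slFieldAut : RingAut F →* MulAut (Matrix.SpecialLinearGroup (Fin 2) F) where
  toFun σ := MonoidHom.toMulEquiv
    (Matrix.SpecialLinearGroup.map (σ : F →+* F)) (Matrix.SpecialLinearGroup.map (σ⁻¹ : RingAut F))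
    (by ext A i j; exact σ.symm_apply_apply (A i j))
    (by ext A i j; exact σ.apply_symm_apply (A i j))
  map_one' := by ext A i j; rfl
  map_mul' σ τ := by ext A i j; rfl

theorem map_center_slFieldAut (σ : RingAut F) :
    (Subgroup.center (Matrix.SpecialLinearGroup (Fin 2) F)).map
      (slFieldAut F σ : _ →* Matrix.SpecialLinearGroup (Fin 2) F) =
        Subgroup.center (Matrix.SpecialLinearGroup (Fin 2) F) :=
  Subgroup.characteristic_iff_map_eq.1 inferInstance (slFieldAut F σ)

/-- The action of the automorphisms of `F` on `PSL₂(F)`, entry by entry. -/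
def pslFieldAut : RingAut F →* MulAut PSL(2, F) where
  toFun σ := QuotientGroup.congr _ _ (slFieldAut F σ) (map_center_slFieldAut F σ)
  map_one' := MulEquiv.ext fun A => by
    induction A using QuotientGroup.induction_on; rfl
  map_mul' σ τ := MulEquiv.ext fun A => by
    induction A using QuotientGroup.induction_on; rfl

/-- The action of the automorphisms of `F` on `PGL₂(F)`, entry by entry. -/
def pglFieldAut : RingAut F →* MulAut PGL(2, F) where
  toFun σ := MonoidHom.toMulEquiv
    (Matrix.ProjGenLinGroup.map (σ : F →+* F)) (Matrix.ProjGenLinGroup.map (σ⁻¹ : RingAut F))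
    (by
      rw [← Matrix.ProjGenLinGroup.map_comp, ← Matrix.ProjGenLinGroup.map_id]
      congr 1; ext a; exact σ.symm_apply_apply a)
    (by
      rw [← Matrix.ProjGenLinGroup.map_comp, ← Matrix.ProjGenLinGroup.map_id]
      congr 1; ext a; exact σ.apply_symm_apply a)
  map_one' := MulEquiv.ext fun A => by
    induction A using Matrix.ProjGenLinGroup.induction_on with | mk A => rfl
  map_mul' σ τ := MulEquiv.ext fun A => by
    induction A using Matrix.ProjGenLinGroup.induction_on with | mk A => rfl

/-- `PSL₂(F) ⋊ C` for a group `C` of field automorphisms. -/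
abbrev PSLSemidirect (C : Subgroup (RingAut F)) : Type v :=
  PSL(2, F) ⋊[(pslFieldAut F).comp C.subtype] C

/-- `PGL₂(F) ⋊ C` for a group `C` of field automorphisms. -/
abbrev PGLSemidirect (C : Subgroup (RingAut F)) : Type v :=
  PGL(2, F) ⋊[(pglFieldAut F).comp C.subtype] C

instance [Finite F] : Finite (RingAut F) := Finite.of_injective _ DFunLike.coe_injective

instance [Finite F] : Finite (Matrix.SpecialLinearGroup (Fin 2) F) :=
  inferInstanceAs (Finite {A : Matrix (Fin 2) (Fin 2) F // A.det = 1})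

instance [Finite F] : Finite PGL(2, F) := Finite.of_surjective _ Matrix.ProjGenLinGroup.mk_surjective

instance [Finite F] (C : Subgroup (RingAut F)) : Finite (PSLSemidirect F C) :=
  Finite.of_equiv _ SemidirectProduct.equivProd.symm

instance [Finite F] (C : Subgroup (RingAut F)) : Finite (PGLSemidirect F C) :=
  Finite.of_equiv _ SemidirectProduct.equivProd.symm

end FieldAutomorphisms

end

/-!
The equivalence is an instance of the Alperin–Dade theorem on isomorphic blocks, applied to
`H ⊴ G = H ⋊ C`, where `C` is commutative of odd order and every `σ ∈ C` centralizes a Sylow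
`2`-subgroup of `H`. In place of Sylow subgroups, everything is expressed by the
equivalent condition that the conjugacy class of `σ` in `G` has odd size.

*Blocks.* Let `e`, `f` be the principal block idempotents of `kG`, `kH`. By Fitting's lemma the
centre of `e kG` is local with residue map the augmentation `ε`, so that `z e - ε(z) e` is nilpotent
for every central `z` (`IsPrincipalBlockIdempotent.isNilpotent_mul_sub`). Take for `z` the sum of a
class of size prime to `p` that lies over `c ∈ G / H`.

* In `k[G / H]` the image of `z` is a non-zero multiple of `c`. Hence `c` acts unipotently on the
  image of `e`, and as it has order prime to `p`, it fixes it. So the coefficients of that image are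
  all equal, and non-zero. Therefore the `H`-part of `e`, which is central in `kH`, has non-zero
  augmentation and is a unit of the local ring `Z(f kH)`. This makes `x ↦ x e` injective on `f kH`
  (`eq_zero_of_map_mul_eq_zero`).
* Up to a scalar `z e` is unipotent in `e kG`, so of `p`-power order, whereas a power of it of
  exponent prime to `p` lies in `kH e`. So `z e` lies in `kH e`, and with it `g e` for `g` in the
  class, since `z ∈ kH g` (`single_mul_mem_mapMulRange`). This makes `f kH → e kG` surjective.

The bimodule `e kG`, with `kH` acting on the right through this isomorphism, induces a Morita
equivalence and is a direct summand of the permutation `G × H`-module `kG`.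

*Groups.* If `F₀` is the fixed field of `σ`, then `GL₂(F₀)` has odd index in `GL₂(F)`, because
`[F : F₀]` and `|F|` are odd. The fixed points of `σ` in `SL₂(F)`, `PSL₂(F)` and `PGL₂(F)` inherit
this, and their index bounds the class of `σ` in the semidirect product.
-/

/-! ### Principal block idempotents -/

section BlockTheory

variable {k : Type u} [Field k] {G : Type v} [Group G] {H : Type w} [Group H]

@[simp]
theorem groupAugmentation_single (g : G) (r : k) :
    groupAugmentation k G (MonoidAlgebra.single g r) = r := by
  simp [groupAugmentation]

theorem groupAugmentation_mapDomainAlgHom (ι : H →* G) (x : k[H]) :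
    groupAugmentation k G (MonoidAlgebra.mapDomainAlgHom k k ι x) = groupAugmentation k H x := by
  have : (groupAugmentation k G).comp (MonoidAlgebra.mapDomainAlgHom k k ι) =
      groupAugmentation k H := by
    ext; simp
  exact DFunLike.congr_fun this x

/-- Centrality in a group algebra may be tested on group elements. -/
theorem mem_center_of_forall_single {z : k[G]}
    (h : ∀ g : G, MonoidAlgebra.single g 1 * z = z * MonoidAlgebra.single g 1) :
    z ∈ Subalgebra.center k k[G] := by
  rw [Subalgebra.mem_center_iff]
  intro b
  induction b using MonoidAlgebra.induction_on with
  | of g => exact h g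
  | add x y hx hy => rw [add_mul, mul_add, hx, hy]
  | smul r x hx => rw [smul_mul_assoc, mul_smul_comm, hx]

instance groupAlgebra_finite [Finite G] : Module.Finite k k[G] :=
  Module.Finite.equiv (MonoidAlgebra.coeffLinearEquiv k (S := k) (M := G)).symm

/-- Fitting's lemma for a commutative artinian ring: every `w` divides an idempotent that acts as
the identity on some power of `w`. -/
theorem exists_isIdempotentElem_mul_of_isArtinianRing {R : Type*} [CommRing R] [IsArtinianRing R]
    (w : R) : ∃ (n : ℕ) (y : R), IsIdempotentElem (w * y) ∧ w ^ n * (w * y) = w ^ n := by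
  obtain ⟨n, y, hy⟩ := IsArtinian.exists_pow_succ_smul_dvd w (1 : R)
  simp only [smul_eq_mul, mul_one] at hy
  have hpow : ∀ m, w ^ n * (w * y) ^ m = w ^ n := by
    intro m
    induction m with
    | zero => simp
    | succ m ih =>
      calc w ^ n * (w * y) ^ (m + 1) = (w ^ n * (w * y) ^ m) * (w * y) := by ring
        _ = w ^ n.succ * y := by rw [ih, Nat.succ_eq_add_one]; ring
        _ = w ^ n := hy
  refine ⟨n, w ^ n * y ^ (n + 1), ?_, ?_⟩
  · calc w * (w ^ n * y ^ (n + 1)) * (w * (w ^ n * y ^ (n + 1)))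
        = (w ^ n * (w * y) ^ (n + 1)) * (w * y ^ (n + 1)) := by ring
      _ = w * (w ^ n * y ^ (n + 1)) := by rw [hpow]; ring
  · calc w ^ n * (w * (w ^ n * y ^ (n + 1))) = w ^ n * (w * y) ^ (n + 1) := by ring
      _ = w ^ n := hpow _

/-- The centre of the principal block is local with residue field `k`, the residue map being the
augmentation. -/
theorem IsPrincipalBlockIdempotent.isNilpotent_mul_sub [Finite G] {e : k[G]}
    (he : IsPrincipalBlockIdempotent e) {z : k[G]} (hz : z ∈ Subalgebra.center k k[G]) :
    IsNilpotent (z * e - groupAugmentation k G z • e) := by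
  have : IsArtinianRing (Subalgebra.center k k[G]) := isArtinian_of_tower k inferInstance
  have hwmem : z * e - groupAugmentation k G z • e ∈ Subalgebra.center k k[G] :=
    sub_mem (mul_mem hz he.central) (Subalgebra.smul_mem _ he.central _)
  obtain ⟨n, ⟨y, hyZ⟩, hidem, hpow⟩ := exists_isIdempotentElem_mul_of_isArtinianRing
    (⟨_, hwmem⟩ : Subalgebra.center k k[G])
  set w := z * e - groupAugmentation k G z • e with hw
  have hew : e * w = w := by
    rw [hw, mul_sub, mul_smul_comm, he.idem.eq, ← mul_assoc, Subalgebra.mem_center_iff.1 hz,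
      mul_assoc, he.idem.eq]
  have hwε : groupAugmentation k G w = 0 := by
    simp [hw, he.augmentation]
  have hprim := he.primitive (w * y) (mul_mem hwmem hyZ) (congrArg Subtype.val hidem)
    (by rw [← mul_assoc, hew])
  have hzero : w * y = 0 := hprim.resolve_right fun h => by
    have := congrArg (groupAugmentation k G) h
    simp [hwε, he.augmentation] at this
  have hpow' : w ^ n * (w * y) = w ^ n := congrArg Subtype.val hpow
  exact ⟨n, by rw [← hpow', hzero, mul_zero]⟩

/-- Automorphisms preserve the trivial module, hence the principal block. -/
theorem IsPrincipalBlockIdempotent.domCongr_eq {f : k[H]}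
    (hf : IsPrincipalBlockIdempotent f) (α : H ≃* H) :
    MonoidAlgebra.domCongr k k α f = f := by
  set Φ := MonoidAlgebra.domCongr k k α
  have hΦ : ∀ z ∈ Subalgebra.center k k[H], Φ z ∈ Subalgebra.center k k[H] := by
    intro z hz
    rw [Subalgebra.mem_center_iff] at hz ⊢
    intro b
    obtain ⟨b, rfl⟩ := Φ.surjective b
    rw [← map_mul, ← map_mul, hz]
  have hΦ' : ∀ z ∈ Subalgebra.center k k[H], Φ.symm z ∈ Subalgebra.center k k[H] := by
    intro z hz
    rw [Subalgebra.mem_center_iff] at hz ⊢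
    intro b
    obtain ⟨b, rfl⟩ := Φ.symm.surjective b
    rw [← map_mul, ← map_mul, hz]
  refine IsPrincipalBlockIdempotent.unique ⟨⟨hf.idem.map Φ, hΦ _ hf.central, ?_, ?_⟩, ?_⟩ hf
  · simpa using hf.ne_zero
  · intro g hg hgi hfg
    have := hf.primitive (Φ.symm g) (hΦ' g hg) (hgi.map Φ.symm)
      (Φ.injective (by simpa using hfg))
    rcases this with h | h
    · left; simpa using h
    · right; rw [← h]; simp
  · have := groupAugmentation_mapDomainAlgHom (α : H →* H) f
    rw [hf.augmentation] at this
    exact this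

/-- The principal block idempotent of a normal subgroup is central in the whole group algebra. -/
theorem IsPrincipalBlockIdempotent.map_mem_center {f : k[H]}
    (hf : IsPrincipalBlockIdempotent f) {ι : H →* G} (hι : Function.Injective ι)
    (hn : ι.range.Normal) :
    MonoidAlgebra.mapDomainAlgHom k k ι f ∈ Subalgebra.center k k[G] := by
  refine mem_center_of_forall_single fun g => ?_
  let E : H ≃* ι.range := MonoidHom.ofInjective hι
  let α : H ≃* H := (E.trans (MulAut.conjNormal g)).trans E.symm
  have hα : ∀ h, ι (α h) = g * ι h * g⁻¹ := by
    intro h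
    have hE : ∀ h, (E h : G) = ι h := fun _ => rfl
    rw [← hE, ← hE]
    simp [α]
  have key : ∀ x : k[H], MonoidAlgebra.single g 1 * MonoidAlgebra.mapDomainAlgHom k k ι x =
      MonoidAlgebra.mapDomainAlgHom k k ι (MonoidAlgebra.domCongr k k α x) *
        MonoidAlgebra.single g 1 := by
    intro x
    induction x using MonoidAlgebra.induction_on with
    | of h => simp [MonoidAlgebra.single_mul_single, hα]
    | add x y hx hy => simp only [map_add, mul_add, add_mul, hx, hy]
    | smul r x hx => simp only [map_smul, mul_smul_comm, smul_mul_assoc, hx]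
  rw [key, hf.domCongr_eq]

/-- The principal block of `kG` lies over that of a normal subgroup. -/
theorem IsPrincipalBlockIdempotent.mul_map_eq {e : k[G]} {f : k[H]}
    (he : IsPrincipalBlockIdempotent e) (hf : IsPrincipalBlockIdempotent f) {ι : H →* G}
    (hι : Function.Injective ι) (hn : ι.range.Normal) :
    e * MonoidAlgebra.mapDomainAlgHom k k ι f = e := by
  set F := MonoidAlgebra.mapDomainAlgHom k k ι f
  have hF := hf.map_mem_center hι hn
  have hFi : IsIdempotentElem F := hf.idem.map _
  have hc : Commute e F := Subalgebra.mem_center_iff.1 hF e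
  refine (he.primitive (e * F) (mul_mem he.central hF) (he.idem.mul_of_commute hc hFi)
    (by rw [← mul_assoc, he.idem.eq])).resolve_left fun h => ?_
  have := congrArg (groupAugmentation k G) h
  rw [map_mul, groupAugmentation_mapDomainAlgHom, he.augmentation, hf.augmentation, map_zero] at this
  simp at this

/-! ### Class sums -/

/-- The sum in `kG` of the elements of the conjugacy class of `g`. -/
noncomputable def classSum (k : Type u) [Field k] [Finite G] (g : G) : k[G] :=
  ∑ x ∈ (Set.toFinite {x : G | IsConj g x}).toFinset, MonoidAlgebra.single x 1

theorem classSum_mem_center [Finite G] (g : G) : classSum k g ∈ Subalgebra.center k k[G] := by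
  refine mem_center_of_forall_single fun a => ?_
  simp only [classSum, Finset.mul_sum, Finset.sum_mul, MonoidAlgebra.single_mul_single, mul_one]
  refine Finset.sum_bij' (fun x _ => a * x * a⁻¹) (fun x _ => a⁻¹ * x * a) ?_ ?_ ?_ ?_ ?_
  · intro x hx
    simp only [Set.Finite.mem_toFinset, Set.mem_ofPred_eq] at hx ⊢
    exact hx.trans (isConj_iff.2 ⟨a, rfl⟩)
  · intro x hx
    simp only [Set.Finite.mem_toFinset, Set.mem_ofPred_eq] at hx ⊢
    exact hx.trans (isConj_iff.2 ⟨a⁻¹, by simp⟩)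
  · intros; group
  · intros; group
  · intros; simp

theorem card_conjugates_eq_index_centralizer [Finite G] (g : G) :
    (Set.toFinite {x : G | IsConj g x}).toFinset.card = (Subgroup.centralizer {g}).index := by
  rw [← Set.ncard_eq_toFinset_card]
  have h : {x : G | IsConj g x} = MulAction.orbit (ConjAct G) g :=
    Set.ext fun x => (isConj_comm.trans ConjAct.mem_orbit_conjAct.symm)
  rw [h, ← MulAction.index_stabilizer, ConjAct.stabilizer_eq_centralizer]
  rfl

theorem groupAugmentation_classSum [Finite G] (g : G) :
    groupAugmentation k G (classSum k g) = ((Subgroup.centralizer {g}).index : k) := by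
  simp [classSum, ← card_conjugates_eq_index_centralizer]

end BlockTheory

section AlperinDade

/-! ### Elements that are unipotent relative to an idempotent -/

/-- In characteristic `p`, an element that differs from an idempotent by a nilpotent has `p`-power
order relative to that idempotent. -/
theorem exists_pow_prime_pow_eq {R : Type*} [Ring R] (p : ℕ) [Fact p.Prime] [CharP R p] {e v : R}
    (he : IsIdempotentElem e) (hev : e * v = v) (hve : v * e = v) (hn : IsNilpotent (v - e)) :
    ∃ m : ℕ, v ^ p ^ m = e := by
  obtain ⟨m, hm⟩ := hn
  refine ⟨m, ?_⟩
  have hp : p.Prime := Fact.out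
  have hc : Commute v e := hve.trans hev.symm
  have h := pow_eq_zero_of_le (Nat.lt_pow_self hp.one_lt (n := m)).le hm
  rw [sub_pow_char_pow_of_commute _ _ hc, he.pow_eq (pow_ne_zero m hp.ne_zero)] at h
  exact sub_eq_zero.1 h

/-- A relatively unipotent element has `p`-power order, so it is a power of its `n`-th power for
every `n` prime to `p`. -/
theorem exists_pow_pow_eq_self {R : Type*} [Ring R] (p : ℕ) [Fact p.Prime] [CharP R p] {e v : R}
    (he : IsIdempotentElem e) (hev : e * v = v) (hve : v * e = v) (hn : IsNilpotent (v - e))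
    {n : ℕ} (hpn : ¬ p ∣ n) : ∃ l : ℕ, (v ^ n) ^ (l + 1) = v := by
  have hp : p.Prime := Fact.out
  obtain ⟨m, hm⟩ := exists_pow_prime_pow_eq p he hev hve hn
  have hn0 : 0 < n := Nat.pos_of_ne_zero fun h => hpn (h ▸ dvd_zero p)
  have hcop : Nat.Coprime n (p ^ m) :=
    Nat.Coprime.pow_right m ((Nat.Prime.coprime_iff_not_dvd hp).2 hpn).symm
  have htot : 0 < (p ^ m).totient := Nat.totient_pos.2 (pow_pos hp.pos m)
  obtain ⟨t, ht⟩ : ∃ t, n ^ (p ^ m).totient = 1 + p ^ m * t := by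
    have h := (Nat.modEq_iff_dvd' (Nat.one_le_pow _ _ hn0)).1 (Nat.ModEq.pow_totient hcop).symm
    obtain ⟨t, ht⟩ := h
    exact ⟨t, by have := Nat.one_le_pow (p ^ m).totient n hn0; omega⟩
  -- By Euler's theorem `n ^ φ(p ^ m) = n * (l + 1)` is `1` modulo the order `p ^ m` of `v`.
  obtain ⟨l, hl⟩ : ∃ l, n ^ ((p ^ m).totient - 1) = l + 1 :=
    ⟨_, (Nat.sub_add_cancel (Nat.one_le_pow _ _ hn0)).symm⟩
  have hvt : ∀ t : ℕ, v * e ^ t = v := by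
    intro t
    induction t with
    | zero => simp
    | succ t ih => rw [pow_succ, ← mul_assoc, ih, hve]
  refine ⟨l, ?_⟩
  rw [← hl, ← pow_mul, ← pow_succ', Nat.sub_add_cancel htot, ht, pow_add, pow_one, pow_mul, hm, hvt]

variable {k : Type u} [Field k] {G : Type v} [Group G] {H : Type w} [Group H]
  {Q : Type x}

/-- If the conjugacy class of `g` has size prime to `p` and the image `c` of `g` in a commutative
quotient has order prime to `p`, then the image of the principal block idempotent is fixed by `c`:
linear characters in the principal block agree with the trivial one on the class sum of `g`. -/
theorem IsPrincipalBlockIdempotent.single_mul_map_eq [CommGroup Q] (p : ℕ) [Fact p.Prime]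
    [CharP k p] [Finite G] {e : k[G]} (he : IsPrincipalBlockIdempotent e) (φ : G →* Q) {g : G}
    (hg : ¬ p ∣ (Subgroup.centralizer {g}).index) (hφ : ¬ p ∣ orderOf (φ g)) :
    MonoidAlgebra.single (φ g) 1 * MonoidAlgebra.mapDomainAlgHom k k φ e =
      MonoidAlgebra.mapDomainAlgHom k k φ e := by
  set m : k := ((Subgroup.centralizer {g}).index : k) with hm
  have hm0 : m ≠ 0 := fun h => hg ((CharP.cast_eq_zero_iff k p _).1 h)
  set E := MonoidAlgebra.mapDomainAlgHom k k φ e with hE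
  have hEi : IsIdempotentElem E := he.idem.map _
  have : CharP k[Q] p := charP_of_injective_algebraMap (FaithfulSMul.algebraMap_injective k k[Q]) p
  have hz : MonoidAlgebra.mapDomainAlgHom k k φ (classSum k g) =
      m • MonoidAlgebra.single (φ g) 1 := by
    rw [classSum, map_sum, hm, ← card_conjugates_eq_index_centralizer, Nat.cast_smul_eq_nsmul]
    refine Finset.sum_eq_card_nsmul fun x hx => ?_
    simp only [Set.Finite.mem_toFinset, Set.mem_ofPred_eq] at hx
    obtain ⟨a, rfl⟩ := isConj_iff.1 hx
    simp
  have hn := (he.isNilpotent_mul_sub (classSum_mem_center g)).map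
    (MonoidAlgebra.mapDomainAlgHom k k φ)
  rw [map_sub, map_mul, hz, groupAugmentation_classSum, map_smul, ← hm, ← hE, smul_mul_assoc,
    ← smul_sub] at hn
  replace hn : IsNilpotent (MonoidAlgebra.single (φ g) 1 * E - E) := by
    have := hn.smul m⁻¹
    rwa [inv_smul_smul₀ hm0] at this
  obtain ⟨l, hl⟩ := exists_pow_pow_eq_self p hEi
    (by rw [mul_left_comm, hEi.eq]) (by rw [mul_assoc, hEi.eq]) hn hφ
  have h0 : orderOf (φ g) ≠ 0 := fun h => hφ (h ▸ dvd_zero p)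
  rw [mul_pow, hEi.pow_eq h0, MonoidAlgebra.single_pow, pow_orderOf_eq_one, one_pow,
    ← MonoidAlgebra.one_def, one_mul, hEi.pow_succ_eq] at hl
  exact hl.symm

/-! ### Restricting the support to a subgroup -/

/-- Restricting the support from `G` to `H` is a map of right `kH`-modules. -/
theorem comapDomain_mul_map {ι : H →* G} (hι : Function.Injective ι) (x : k[G]) (y : k[H]) :
    MonoidAlgebra.comapDomain ι hι (x * MonoidAlgebra.mapDomainAlgHom k k ι y) =
      MonoidAlgebra.comapDomain ι hι x * y := by
  induction x using MonoidAlgebra.induction_linear with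
  | zero => simp
  | add a b ha hb => rw [add_mul, MonoidAlgebra.comapDomain_add, ha, hb,
      MonoidAlgebra.comapDomain_add, add_mul]
  | single g r =>
    induction y using MonoidAlgebra.induction_linear with
    | zero => simp
    | add a b ha hb => rw [map_add, mul_add, MonoidAlgebra.comapDomain_add, ha, hb, mul_add]
    | single h s =>
      simp only [MonoidAlgebra.mapDomainAlgHom_apply, MonoidAlgebra.mapDomain_single,
        MonoidAlgebra.single_mul_single]
      by_cases hg : g ∈ Set.range ι
      · obtain ⟨a, rfl⟩ := hg
        rw [← map_mul, MonoidAlgebra.comapDomain_single_map, MonoidAlgebra.comapDomain_single_map,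
          MonoidAlgebra.single_mul_single]
      · have hg' : g * ι h ∉ Set.range ι := by
          rintro ⟨a, ha⟩
          exact hg ⟨a * h⁻¹, by simp [ha]⟩
        rw [MonoidAlgebra.comapDomain_single_of_not_mem_range hg',
          MonoidAlgebra.comapDomain_single_of_not_mem_range hg, zero_mul]

/-- Restricting the support from `G` to `H` is a map of left `kH`-modules. -/
theorem comapDomain_map_mul {ι : H →* G} (hι : Function.Injective ι) (x : k[G]) (y : k[H]) :
    MonoidAlgebra.comapDomain ι hι (MonoidAlgebra.mapDomainAlgHom k k ι y * x) =
      y * MonoidAlgebra.comapDomain ι hι x := by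
  induction x using MonoidAlgebra.induction_linear with
  | zero => simp
  | add a b ha hb => rw [mul_add, MonoidAlgebra.comapDomain_add, ha, hb,
      MonoidAlgebra.comapDomain_add, mul_add]
  | single g r =>
    induction y using MonoidAlgebra.induction_linear with
    | zero => simp
    | add a b ha hb => rw [map_add, add_mul, MonoidAlgebra.comapDomain_add, ha, hb, add_mul]
    | single h s =>
      simp only [MonoidAlgebra.mapDomainAlgHom_apply, MonoidAlgebra.mapDomain_single,
        MonoidAlgebra.single_mul_single]
      by_cases hg : g ∈ Set.range ι
      · obtain ⟨a, rfl⟩ := hg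
        rw [← map_mul, MonoidAlgebra.comapDomain_single_map, MonoidAlgebra.comapDomain_single_map,
          MonoidAlgebra.single_mul_single]
      · have hg' : ι h * g ∉ Set.range ι := by
          rintro ⟨a, ha⟩
          exact hg ⟨h⁻¹ * a, by simp [ha]⟩
        rw [MonoidAlgebra.comapDomain_single_of_not_mem_range hg',
          MonoidAlgebra.comapDomain_single_of_not_mem_range hg, mul_zero]

/-- The augmentation of the `H`-part of `x` is the coefficient at `1` of the image of `x` in the
algebra of the quotient group. -/
theorem groupAugmentation_comapDomain [Group Q] {ι : H →* G} (hι : Function.Injective ι)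
    {φ : G →* Q} (hex : ι.range = φ.ker) (x : k[G]) :
    groupAugmentation k H (MonoidAlgebra.comapDomain ι hι x) =
      (MonoidAlgebra.mapDomainAlgHom k k φ x).coeff 1 := by
  induction x using MonoidAlgebra.induction_linear with
  | zero => simp
  | add a b ha hb => simp only [MonoidAlgebra.comapDomain_add, map_add, ha, hb,
      MonoidAlgebra.coeff_add, Finsupp.add_apply]
  | single g r =>
    by_cases hg : g ∈ Set.range ι
    · have : φ g = 1 := MonoidHom.mem_ker.1 (hex ▸ (MonoidHom.mem_range.2 hg))
      obtain ⟨a, rfl⟩ := hg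
      simp [this]
    · have : φ g ≠ 1 := fun h => hg (MonoidHom.mem_range.1 (hex ▸ MonoidHom.mem_ker.2 h))
      rw [MonoidAlgebra.comapDomain_single_of_not_mem_range hg]
      simp [this]

end AlperinDade

section AlperinDadeIso

variable {k : Type u} [Field k] {G : Type v} [Group G] {H : Type w} [Group H]
  {Q : Type x}

/-! ### The isomorphism of principal blocks -/

/-- Multiplication by `e` is injective on the principal block of `kH`: the image of `e` in the
quotient group algebra has non-zero coefficient at `1`, so the `H`-part of `e` is a unit of the
centre of that block. -/
theorem eq_zero_of_map_mul_eq_zero [CommGroup Q] [Finite Q] (p : ℕ) [Fact p.Prime]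
    [CharP k p] [Finite G] [Finite H] {e : k[G]} {f : k[H]} (he : IsPrincipalBlockIdempotent e)
    (hf : IsPrincipalBlockIdempotent f) {ι : H →* G} (hι : Function.Injective ι)
    {φ : G →* Q} (hex : ι.range = φ.ker) (hQ : ¬ p ∣ Nat.card Q)
    (hcl : ∀ c : Q, ∃ g, φ g = c ∧ ¬ p ∣ (Subgroup.centralizer {g}).index)
    {x : k[H]} (hxf : x * f = x) (hx : MonoidAlgebra.mapDomainAlgHom k k ι x * e = 0) :
    x = 0 := by
  set E := MonoidAlgebra.mapDomainAlgHom k k φ e with hE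
  have hconst : ∀ c, E.coeff c = E.coeff 1 := by
    intro c
    obtain ⟨g, rfl, hg⟩ := hcl c
    have h := he.single_mul_map_eq p φ hg fun h => hQ (h.trans (orderOf_dvd_natCard _))
    rw [← hE] at h
    conv_lhs => rw [← h]
    rw [MonoidAlgebra.coeff_single_mul_apply]
    simp
  have hε : groupAugmentation k Q E = 1 := by
    rw [hE, groupAugmentation_mapDomainAlgHom, he.augmentation]
  have h1 : E.coeff 1 ≠ 0 := by
    intro h0
    have : E = 0 := by
      ext c
      rw [hconst, h0]
      rfl
    rw [this, map_zero] at hε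
    exact zero_ne_one hε
  set r := MonoidAlgebra.comapDomain ι hι e with hr
  have hrc : r ∈ Subalgebra.center k k[H] := by
    rw [Subalgebra.mem_center_iff]
    intro y
    rw [← comapDomain_map_mul, ← comapDomain_mul_map, Subalgebra.mem_center_iff.1 he.central]
  have hrε : groupAugmentation k H r = E.coeff 1 := groupAugmentation_comapDomain hι hex e
  have hxr : x * r = 0 := by
    rw [hr, ← comapDomain_map_mul, hx, MonoidAlgebra.comapDomain_zero]
  -- As `x r = 0`, the nilpotent element `r f - ε(r) f` acts on `x` as the scalar `-ε(r) ≠ 0`.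
  obtain ⟨n, hn⟩ := hf.isNilpotent_mul_sub hrc
  rw [hrε] at hn
  have hstep : x * (r * f - E.coeff 1 • f) = (-E.coeff 1) • x := by
    rw [mul_sub, ← mul_assoc, hxr, zero_mul, mul_smul_comm, hxf, zero_sub, neg_smul]
  have hpow : ∀ n : ℕ, x * (r * f - E.coeff 1 • f) ^ n = (-E.coeff 1) ^ n • x := by
    intro n
    induction n with
    | zero => simp
    | succ n ih => rw [pow_succ, ← mul_assoc, ih, smul_mul_assoc, hstep, smul_smul, pow_succ]
  have := hpow n
  rw [hn, mul_zero] at this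
  exact (smul_eq_zero.1 this.symm).resolve_left (pow_ne_zero _ (neg_ne_zero.2 h1))

/-- Class sums are homogeneous for the grading of `kG` by the quotient group. -/
theorem exists_classSum_pow_eq [CommGroup Q] [Finite G] {ι : H →* G} {φ : G →* Q}
    (hex : ι.range = φ.ker) (g : G) (n : ℕ) :
    ∃ y : k[H], classSum k g ^ n =
      MonoidAlgebra.mapDomainAlgHom k k ι y * MonoidAlgebra.single (g ^ n) 1 := by
  have h1 : ∃ y : k[H], classSum k g =
      MonoidAlgebra.mapDomainAlgHom k k ι y * MonoidAlgebra.single g 1 := by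
    let S : Submodule k k[G] := LinearMap.range
      (LinearMap.mulRight k (MonoidAlgebra.single g (1 : k)) ∘ₗ
        (MonoidAlgebra.mapDomainAlgHom k k ι).toLinearMap)
    have hS : classSum k g ∈ S := by
      refine Submodule.sum_mem _ fun x hx => ?_
      simp only [Set.Finite.mem_toFinset, Set.mem_ofPred_eq] at hx
      obtain ⟨a, rfl⟩ := isConj_iff.1 hx
      have : a * g * a⁻¹ * g⁻¹ ∈ ι.range := by
        rw [hex, MonoidHom.mem_ker]
        simp
      obtain ⟨h, hh⟩ := this
      exact ⟨MonoidAlgebra.single h 1, by simp [hh, MonoidAlgebra.single_mul_single]⟩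
    obtain ⟨y, hy⟩ := hS
    exact ⟨y, hy.symm⟩
  obtain ⟨y, hy⟩ := h1
  induction n with
  | zero => exact ⟨1, by simp [MonoidAlgebra.one_def]⟩
  | succ n ih =>
    obtain ⟨y', hy'⟩ := ih
    refine ⟨y * y', ?_⟩
    have hc := Subalgebra.mem_center_iff.1 (pow_mem (classSum_mem_center (k := k) g) n)
      (MonoidAlgebra.mapDomainAlgHom k k ι y)
    calc classSum k g ^ (n + 1)
        = classSum k g ^ n * MonoidAlgebra.mapDomainAlgHom k k ι y * MonoidAlgebra.single g 1 := by
          rw [pow_succ, mul_assoc, ← hy]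
      _ = _ := by
          rw [← hc, hy', map_mul, mul_assoc, mul_assoc, MonoidAlgebra.single_mul_single, mul_one,
            ← pow_succ, mul_assoc]

/-- The multiples of `e` by elements of `kH`, a subspace of `kG`. -/
noncomputable def mapMulRange (ι : H →* G) (e : k[G]) : Submodule k k[G] :=
  LinearMap.range (LinearMap.mulRight k e ∘ₗ (MonoidAlgebra.mapDomainAlgHom k k ι).toLinearMap)

theorem mem_mapMulRange {ι : H →* G} {e x : k[G]} :
    x ∈ mapMulRange ι e ↔ ∃ y : k[H], MonoidAlgebra.mapDomainAlgHom k k ι y * e = x :=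
  Iff.rfl

theorem mul_mem_mapMulRange {ι : H →* G} {e : k[G]} (he : IsPrincipalBlockIdempotent e)
    {x x' : k[G]} (hx : x ∈ mapMulRange ι e) (hx' : x' ∈ mapMulRange ι e) :
    x * x' ∈ mapMulRange ι e := by
  obtain ⟨y, rfl⟩ := mem_mapMulRange.1 hx
  obtain ⟨y', rfl⟩ := mem_mapMulRange.1 hx'
  refine mem_mapMulRange.2 ⟨y * y', ?_⟩
  rw [map_mul, mul_assoc, mul_assoc, ← mul_assoc e, ← Subalgebra.mem_center_iff.1 he.central,
    mul_assoc _ e e, he.idem.eq]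

/-- A group element `g` whose class has size prime to `p` acts on the principal block as an element
of `kH`: the class sum does, being central and of `p'`-order modulo `kH`, and it
differs from `g` by an element of `kH`. -/
theorem single_mul_mem_mapMulRange [CommGroup Q] (p : ℕ) [Fact p.Prime]
    [CharP k p] [Finite G] {e : k[G]} (he : IsPrincipalBlockIdempotent e)
    {ι : H →* G} {φ : G →* Q} (hex : ι.range = φ.ker) {g : G} (hφ : ¬ p ∣ orderOf (φ g))
    (hg : ¬ p ∣ (Subgroup.centralizer {g}).index) :
    MonoidAlgebra.single g 1 * e ∈ mapMulRange ι e := by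
  set Φ := MonoidAlgebra.mapDomainAlgHom k k ι
  set m : k := ((Subgroup.centralizer {g}).index : k) with hm
  have hm0 : m ≠ 0 := fun h => hg ((CharP.cast_eq_zero_iff k p _).1 h)
  have : CharP k[G] p := charP_of_injective_algebraMap (FaithfulSMul.algebraMap_injective k k[G]) p
  have hec := Subalgebra.mem_center_iff.1 he.central
  have hpow_mem : ∀ {x : k[G]}, x ∈ mapMulRange ι e → ∀ l : ℕ, x ^ (l + 1) ∈ mapMulRange ι e := by
    intro x hx l
    induction l with
    | zero => simpa using hx
    | succ l ih => rw [pow_succ]; exact mul_mem_mapMulRange he ih hx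
  set z := classSum k g with hz
  set v := m⁻¹ • (z * e) with hv
  have hve : v * e = v := by rw [hv, smul_mul_assoc, mul_assoc, he.idem.eq]
  have hev : e * v = v := by rw [← hec, hve]
  have hvn : IsNilpotent (v - e) := by
    have := (he.isNilpotent_mul_sub (classSum_mem_center g)).smul m⁻¹
    rwa [groupAugmentation_classSum, ← hm, smul_sub, inv_smul_smul₀ hm0] at this
  have hn0 : orderOf (φ g) ≠ 0 := fun h => hφ (h ▸ dvd_zero p)
  have hvmem : v ∈ mapMulRange ι e := by
    obtain ⟨l, hl⟩ := exists_pow_pow_eq_self p he.idem hev hve hvn hφ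
    rw [← hl]
    refine hpow_mem ?_ l
    obtain ⟨y, hy⟩ := exists_classSum_pow_eq (k := k) hex g (orderOf (φ g))
    have hker : g ^ orderOf (φ g) ∈ ι.range := by
      rw [hex, MonoidHom.mem_ker, map_pow, pow_orderOf_eq_one]
    obtain ⟨h, hh⟩ := hker
    rw [hv, smul_pow, (show Commute z e from (hec z)).mul_pow, he.idem.pow_eq hn0, hz, hy]
    refine Submodule.smul_mem _ _ (mem_mapMulRange.2 ⟨y * MonoidAlgebra.single h 1, ?_⟩)
    rw [map_mul]
    simp [hh]
  obtain ⟨j, hj⟩ := exists_pow_prime_pow_eq p he.idem hev hve hvn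
  obtain ⟨N, hN⟩ : ∃ N, p ^ j = N + 1 :=
    ⟨_, (Nat.sub_add_cancel (Nat.one_le_pow _ _ (Fact.out : p.Prime).pos)).symm⟩
  obtain ⟨y, hy⟩ := exists_classSum_pow_eq (k := k) hex g 1
  rw [pow_one, pow_one, ← hz] at hy
  -- The class sum is `y g` with `y ∈ kH`, so `g e` is `v` divided by `u`, up to a scalar.
  set u := Φ y * e with hu
  have humem : u ∈ mapMulRange ι e := mem_mapMulRange.2 ⟨y, rfl⟩
  have hug : u * (MonoidAlgebra.single g 1 * e) = m • v := by
    rw [hv, smul_inv_smul₀ hm0, hy, hu, mul_assoc, ← mul_assoc e, ← hec, mul_assoc _ e e,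
      he.idem.eq, mul_assoc]
  have hut : u * ((MonoidAlgebra.single g 1 * e) * (m⁻¹ • v ^ N)) = e := by
    rw [← mul_assoc, hug, smul_mul_smul_comm, mul_inv_cancel₀ hm0, one_smul, ← pow_succ', ← hN, hj]
  -- A right inverse in `e kG` makes `u` invertible in the finite-dimensional algebra `kH e`.
  let R : mapMulRange ι e →ₗ[k] mapMulRange ι e :=
    (LinearMap.mulRight k u).restrict fun x hx => mul_mem_mapMulRange he hx humem
  have hRinj : Function.Injective R := by
    rw [injective_iff_map_eq_zero]
    rintro ⟨x, hx⟩ hRx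
    have hxu : x * u = 0 := congrArg Subtype.val hRx
    obtain ⟨y', rfl⟩ := mem_mapMulRange.1 hx
    have : Φ y' * e * e = 0 := by
      refine (congrArg (Φ y' * e * ·) hut).symm.trans ?_
      rw [← mul_assoc (Φ y' * e), hxu, zero_mul]
    rw [mul_assoc, he.idem.eq] at this
    exact Subtype.ext this
  obtain ⟨⟨w, hw⟩, hRw⟩ := LinearMap.injective_iff_surjective.1 hRinj
    ⟨e, mem_mapMulRange.2 ⟨1, by rw [map_one, one_mul]⟩⟩
  have hwu : w * u = e := congrArg Subtype.val hRw
  have : MonoidAlgebra.single g 1 * e = m • (w * v) := by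
    rw [← mul_smul_comm, ← hug, ← mul_assoc, hwu, ← mul_assoc, ← hec, mul_assoc, he.idem.eq]
  rw [this]
  exact Submodule.smul_mem _ _ (mul_mem_mapMulRange he hw hvmem)

/-- `kG e = kH e` if every coset of `H` meets a conjugacy class of size prime to `p`. -/
theorem mul_mem_mapMulRange_of_forall [CommGroup Q] [Finite Q] (p : ℕ) [Fact p.Prime]
    [CharP k p] [Finite G] {e : k[G]} (he : IsPrincipalBlockIdempotent e)
    {ι : H →* G} {φ : G →* Q} (hex : ι.range = φ.ker) (hQ : ¬ p ∣ Nat.card Q)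
    (hcl : ∀ c : Q, ∃ g, φ g = c ∧ ¬ p ∣ (Subgroup.centralizer {g}).index) (x : k[G]) :
    x * e ∈ mapMulRange ι e := by
  induction x using MonoidAlgebra.induction_on with
  | of a =>
    obtain ⟨g, hga, hg⟩ := hcl (φ a)
    have hmem := single_mul_mem_mapMulRange p he hex
      (fun h => hQ (h.trans (orderOf_dvd_natCard (φ g)))) hg
    obtain ⟨y, hy⟩ := mem_mapMulRange.1 hmem
    have : a * g⁻¹ ∈ ι.range := by
      rw [hex, MonoidHom.mem_ker]
      simp [hga]
    obtain ⟨h, hh⟩ := this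
    refine mem_mapMulRange.2 ⟨MonoidAlgebra.single h 1 * y, ?_⟩
    rw [map_mul, mul_assoc, hy, ← mul_assoc]
    simp [hh, MonoidAlgebra.single_mul_single]
  | add x y hx hy => rw [add_mul]; exact add_mem hx hy
  | smul r x hx => rw [smul_mul_assoc]; exact Submodule.smul_mem _ _ hx

end AlperinDadeIso

/-! ### The bimodule of an algebra isomorphism -/

namespace Bimodule

variable {k : Type u} [CommRing k] {A : Type v} {B : Type w} [Ring A] [Algebra k A] [Ring B]
  [Algebra k B]

/-- The algebra `A` as an `(A, B)`-bimodule, with `B` acting on the right through an algebra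
isomorphism `ψ : B ≃ A`. -/
abbrev twistRight (ψ : B ≃ₐ[k] A) : Bimodule.{u, v, w, v} k A B where
  carrier := A
  left := Algebra.lsmul k k A
  right := (Algebra.lsmul k k A : Aᵐᵒᵖ →ₐ[k] Module.End k A).comp (AlgEquiv.op ψ).toAlgHom
  comm a b := LinearMap.ext fun m => (mul_assoc a m (ψ b.unop)).symm

/-- The algebra `A` as a `(B, A)`-bimodule, with `B` acting on the left through an algebra
isomorphism `ψ : B ≃ A`. -/
abbrev twistLeft (ψ : B ≃ₐ[k] A) : Bimodule.{u, w, v, v} k B A where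
  carrier := A
  left := (Algebra.lsmul k k A : A →ₐ[k] Module.End k A).comp ψ.toAlgHom
  right := Algebra.lsmul k k A
  comm b a := LinearMap.ext fun m => (mul_assoc (ψ b) m a.unop).symm

theorem twistRight_tensor_twistLeft_iso (ψ : B ≃ₐ[k] A) :
    ((twistRight ψ).tensor (twistLeft ψ)).Iso (regular k A) := by
  -- Multiplication, with inverse `a ↦ a ⊗ 1`.
  let μ : (A ⊗[k] A) ⧸ tensorRel (twistRight ψ) (twistLeft ψ) →ₗ[k] A :=
    (tensorRel (twistRight ψ) (twistLeft ψ)).liftQ (LinearMap.mul' k A) <| by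
      refine Submodule.span_le.2 ?_
      rintro _ ⟨m, b, n, rfl⟩
      change LinearMap.mul' k A ((m * ψ b) ⊗ₜ[k] n - m ⊗ₜ[k] (ψ b * n)) = 0
      simp [mul_assoc]
  let ν : A →ₗ[k] (A ⊗[k] A) ⧸ tensorRel (twistRight ψ) (twistLeft ψ) :=
    (tensorRel (twistRight ψ) (twistLeft ψ)).mkQ ∘ₗ (TensorProduct.mk k A A).flip 1
  have hμν : μ ∘ₗ ν = LinearMap.id := LinearMap.ext fun a => by
    change LinearMap.mul' k A (a ⊗ₜ[k] 1) = a
    simp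
  have hνμ : ν ∘ₗ μ = LinearMap.id := by
    refine Submodule.linearMap_qext _ (TensorProduct.ext' fun m n => ?_)
    change (tensorRel (twistRight ψ) (twistLeft ψ)).mkQ ((LinearMap.mul' k A (m ⊗ₜ[k] n)) ⊗ₜ[k] 1) =
      (tensorRel (twistRight ψ) (twistLeft ψ)).mkQ (m ⊗ₜ[k] n)
    refine (Submodule.Quotient.eq _).2 (Submodule.subset_span ⟨m, ψ.symm n, 1, ?_⟩)
    change _ = (m * ψ (ψ.symm n)) ⊗ₜ[k] (1 : A) - m ⊗ₜ[k] (ψ (ψ.symm n) * 1)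
    simp
  refine ⟨LinearEquiv.ofLinearMap μ ν hμν hνμ, fun a => ?_, fun a => ?_⟩
  · refine LinearMap.congr_fun (f := μ ∘ₗ ((twistRight ψ).tensor (twistLeft ψ)).left a)
      (g := LinearMap.mulLeft k a ∘ₗ μ) ?_
    refine Submodule.linearMap_qext _ (TensorProduct.ext' fun m n => ?_)
    change LinearMap.mul' k A ((a * m) ⊗ₜ[k] n) = a * LinearMap.mul' k A (m ⊗ₜ[k] n)
    simp [mul_assoc]
  · refine LinearMap.congr_fun (f := μ ∘ₗ ((twistRight ψ).tensor (twistLeft ψ)).right a)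
      (g := LinearMap.mulRight k a.unop ∘ₗ μ) ?_
    refine Submodule.linearMap_qext _ (TensorProduct.ext' fun m n => ?_)
    change LinearMap.mul' k A (m ⊗ₜ[k] (n * a.unop)) = LinearMap.mul' k A (m ⊗ₜ[k] n) * a.unop
    simp [mul_assoc]

theorem twistLeft_tensor_twistRight_iso (ψ : B ≃ₐ[k] A) :
    ((twistLeft ψ).tensor (twistRight ψ)).Iso (regular k B) := by
  -- Multiplication, with inverse `a ↦ a ⊗ 1`, carried from `A` to `B`.
  let μ : (A ⊗[k] A) ⧸ tensorRel (twistLeft ψ) (twistRight ψ) →ₗ[k] A :=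
    (tensorRel (twistLeft ψ) (twistRight ψ)).liftQ (LinearMap.mul' k A) <| by
      refine Submodule.span_le.2 ?_
      rintro _ ⟨m, b, n, rfl⟩
      change LinearMap.mul' k A ((m * b) ⊗ₜ[k] n - m ⊗ₜ[k] (b * n)) = 0
      simp [mul_assoc]
  let ν : A →ₗ[k] (A ⊗[k] A) ⧸ tensorRel (twistLeft ψ) (twistRight ψ) :=
    (tensorRel (twistLeft ψ) (twistRight ψ)).mkQ ∘ₗ (TensorProduct.mk k A A).flip 1
  have hμν : μ ∘ₗ ν = LinearMap.id := LinearMap.ext fun a => by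
    change LinearMap.mul' k A (a ⊗ₜ[k] 1) = a
    simp
  have hνμ : ν ∘ₗ μ = LinearMap.id := by
    refine Submodule.linearMap_qext _ (TensorProduct.ext' fun m n => ?_)
    change (tensorRel (twistLeft ψ) (twistRight ψ)).mkQ ((LinearMap.mul' k A (m ⊗ₜ[k] n)) ⊗ₜ[k] 1) =
      (tensorRel (twistLeft ψ) (twistRight ψ)).mkQ (m ⊗ₜ[k] n)
    refine (Submodule.Quotient.eq _).2 (Submodule.subset_span ⟨m, n, 1, ?_⟩)
    change _ = (m * n) ⊗ₜ[k] (1 : A) - m ⊗ₜ[k] (n * 1)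
    simp
  let Λ₀ : ((A ⊗[k] A) ⧸ tensorRel (twistLeft ψ) (twistRight ψ)) ≃ₗ[k] A :=
    LinearEquiv.ofLinearMap μ ν hμν hνμ
  let Λ : ((A ⊗[k] A) ⧸ tensorRel (twistLeft ψ) (twistRight ψ)) ≃ₗ[k] B :=
    Λ₀.trans ψ.symm.toLinearEquiv
  refine ⟨Λ, fun a => ?_, fun a => ?_⟩
  · refine LinearMap.congr_fun
      (f := ψ.symm.toLinearMap ∘ₗ μ ∘ₗ ((twistLeft ψ).tensor (twistRight ψ)).left a)
      (g := LinearMap.mulLeft k a ∘ₗ ψ.symm.toLinearMap ∘ₗ μ) ?_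
    refine Submodule.linearMap_qext _ (TensorProduct.ext' fun m n => ?_)
    change ψ.symm (LinearMap.mul' k A ((ψ a * m) ⊗ₜ[k] n)) =
      a * ψ.symm (LinearMap.mul' k A (m ⊗ₜ[k] n))
    simp [mul_assoc]
  · refine LinearMap.congr_fun
      (f := ψ.symm.toLinearMap ∘ₗ μ ∘ₗ ((twistLeft ψ).tensor (twistRight ψ)).right a)
      (g := LinearMap.mulRight k a.unop ∘ₗ ψ.symm.toLinearMap ∘ₗ μ) ?_
    refine Submodule.linearMap_qext _ (TensorProduct.ext' fun m n => ?_)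
    change ψ.symm (LinearMap.mul' k A (m ⊗ₜ[k] (n * ψ a.unop))) =
      ψ.symm (LinearMap.mul' k A (m ⊗ₜ[k] n)) * a.unop
    simp [mul_assoc]

theorem twistRight_inducesMoritaEquivalence [Module.Finite k A] (ψ : B ≃ₐ[k] A) :
    (twistRight ψ).InducesMoritaEquivalence :=
  ⟨inferInstance, twistLeft ψ, inferInstance, twistRight_tensor_twistLeft_iso ψ,
    twistLeft_tensor_twistRight_iso ψ⟩

end Bimodule

/-! ### Splendid equivalences from algebra isomorphisms -/

section SplendidIso

variable {k : Type u} [Field k] {G H : Type v} [Group G] [Group H]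

/-- The inclusion of a block algebra into the group algebra, as a linear map. -/
noncomputable def BlockAlgebra.subtype {e : k[G]} (he : IsBlockIdempotent e) : BlockAlgebra he →ₗ[k] k[G] where
  toFun a := a.1
  map_add' _ _ := rfl
  map_smul' _ _ := rfl

/-- The projection `x ↦ e x` of the group algebra onto a block algebra. -/
noncomputable def BlockAlgebra.proj {e : k[G]} (he : IsBlockIdempotent e) : k[G] →ₗ[k] BlockAlgebra he where
  toFun x := ⟨e * x, (Subsemigroup.mem_corner_iff he.idem).2
    ⟨by rw [← mul_assoc, he.idem.eq], by
      rw [mul_assoc, Subalgebra.mem_center_iff.1 he.central, ← mul_assoc, he.idem.eq]⟩⟩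
  map_add' x y := Subtype.ext (mul_add e x y)
  map_smul' r x := Subtype.ext (mul_smul_comm r e x)

instance BlockAlgebra.finite [Finite G] {e : k[G]} (he : IsBlockIdempotent e) :
    Module.Finite k (BlockAlgebra he) :=
  Module.Finite.of_injective (BlockAlgebra.subtype he) Subtype.val_injective

theorem BlockAlgebra.mul_left {e : k[G]} (he : IsBlockIdempotent e) (a : BlockAlgebra he) :
    e * a.1 = a.1 := ((Subsemigroup.mem_corner_iff he.idem).1 a.2).1

theorem BlockAlgebra.mul_right {e : k[G]} (he : IsBlockIdempotent e) (a : BlockAlgebra he) :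
    a.1 * e = a.1 := ((Subsemigroup.mem_corner_iff he.idem).1 a.2).2

/-- If `ι : H → G` induces an isomorphism of blocks, then these are splendidly Morita equivalent:
the bimodule `e kG` is a summand of `kG`, which is a permutation module for `G × H`. -/
theorem SplendidlyMoritaEquivalent.of_algEquiv [Finite G] {e : k[G]} {f : k[H]}
    (he : IsBlockIdempotent e) (hf : IsBlockIdempotent f) (ι : H →* G)
    (ψ : BlockAlgebra hf ≃ₐ[k] BlockAlgebra he)
    (hψ : ∀ h, ψ (toBlockAlgebra hf h) = toBlockAlgebra he (ι h)) :
    SplendidlyMoritaEquivalent he hf := by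
  refine ⟨Bimodule.twistRight ψ, Bimodule.twistRight_inducesMoritaEquivalence ψ, ?_⟩
  let _ : MulAction (G × H) G :=
    { smul := fun p x => p.1 * x * ι p.2⁻¹
      one_smul := fun x => by
        change (1 : G) * x * ι (1 : H)⁻¹ = x
        simp
      mul_smul := fun p q x => by
        change p.1 * q.1 * x * ι (p.2 * q.2)⁻¹ = p.1 * (q.1 * x * ι q.2⁻¹) * ι p.2⁻¹
        simp [mul_assoc] }
  have hsmul : ∀ (p : G × H) (x : G), p • x = p.1 * x * ι p.2⁻¹ := fun _ _ => rfl
  have haction : ∀ (p : G × H) (x : k[G]), Representation.ofMulAction k (G × H) G p x =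
      MonoidAlgebra.single p.1 1 * x * MonoidAlgebra.single (ι p.2⁻¹) 1 := by
    intro p x
    induction x using MonoidAlgebra.induction_linear with
    | zero => simp
    | add a b ha hb => rw [map_add, ha, hb, mul_add, add_mul]
    | single g r => simp [hsmul, MonoidAlgebra.single_mul_single]
  have hrep : ∀ (p : G × H) (a : BlockAlgebra he),
      ((Bimodule.twistRight ψ).toRepresentation p a : BlockAlgebra he).1 =
        MonoidAlgebra.single p.1 1 * a.1 * MonoidAlgebra.single (ι p.2⁻¹) 1 := by
    intro p a
    change (toBlockAlgebra he p.1 * (a * ψ (toBlockAlgebra hf p.2⁻¹)) : BlockAlgebra he).1 = _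
    rw [hψ]
    change (e * MonoidAlgebra.single p.1 1) * (a.1 * (e * MonoidAlgebra.single (ι p.2⁻¹) 1)) = _
    rw [← mul_assoc a.1, BlockAlgebra.mul_right, ← Subalgebra.mem_center_iff.1 he.central,
      mul_assoc _ e, ← mul_assoc e, BlockAlgebra.mul_left, mul_assoc]
  refine ⟨G, inferInstance, inferInstance,
    { BlockAlgebra.subtype he with isIntertwining' := fun p => LinearMap.ext fun a => ?_ },
    { BlockAlgebra.proj he with isIntertwining' := fun p => LinearMap.ext fun x => ?_ },
    fun a => Subtype.ext (BlockAlgebra.mul_left he a)⟩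
  · change ((Bimodule.twistRight ψ).toRepresentation p a : BlockAlgebra he).1 =
      Representation.ofMulAction k (G × H) G p a.1
    rw [hrep, haction]
  · refine Subtype.ext ?_
    refine Eq.trans ?_ (hrep p (BlockAlgebra.proj he x)).symm
    change e * Representation.ofMulAction k (G × H) G p x =
      MonoidAlgebra.single p.1 1 * (e * x) * MonoidAlgebra.single (ι p.2⁻¹) 1
    rw [haction, ← mul_assoc _ e, Subalgebra.mem_center_iff.1 he.central]
    simp only [mul_assoc]

/-- The algebra map `x ↦ e Φ(x)` between block algebras induced by a map `Φ` of group algebras. -/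
noncomputable def BlockAlgebra.mapAlgHom {e : k[G]} {f : k[H]} (he : IsBlockIdempotent e)
    (hf : IsBlockIdempotent f) (Φ : k[H] →ₐ[k] k[G]) (hef : e * Φ f = e) :
    BlockAlgebra hf →ₐ[k] BlockAlgebra he :=
  AlgHom.ofLinearMap (BlockAlgebra.proj he ∘ₗ Φ.toLinearMap ∘ₗ BlockAlgebra.subtype hf)
    (Subtype.ext hef) fun a b => Subtype.ext <| by
      have hmul : ∀ x y : k[H], e * Φ (x * y) = (e * Φ x) * (e * Φ y) := by
        intro x y
        rw [map_mul, mul_assoc e (Φ x), ← mul_assoc (Φ x) e,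
          Subalgebra.mem_center_iff.1 he.central (Φ x), mul_assoc e (Φ x), ← mul_assoc e e,
          he.idem.eq]
      exact hmul a.1 b.1

/-- The Alperin–Dade theorem for principal blocks: let `H` be normal in `G` with commutative
quotient `Q` of order prime to `p`, each coset of which meets a conjugacy class of `G` of size
prime to `p`. Then the principal blocks of `kG` and `kH` are isomorphic, by `x ↦ x e`, and
splendidly Morita equivalent. -/
theorem IsPrincipalBlockIdempotent.splendidlyMoritaEquivalent {Q : Type x} [CommGroup Q] [Finite Q]
    (p : ℕ) [Fact p.Prime] [CharP k p] [Finite G] [Finite H] {e : k[G]} {f : k[H]}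
    (he : IsPrincipalBlockIdempotent e) (hf : IsPrincipalBlockIdempotent f) {ι : H →* G}
    (hι : Function.Injective ι) {φ : G →* Q} (hex : ι.range = φ.ker) (hQ : ¬ p ∣ Nat.card Q)
    (hcl : ∀ c : Q, ∃ g, φ g = c ∧ ¬ p ∣ (Subgroup.centralizer {g}).index) :
    SplendidlyMoritaEquivalent he.toIsBlockIdempotent hf.toIsBlockIdempotent := by
  have hn : ι.range.Normal := hex ▸ inferInstance
  have hec := Subalgebra.mem_center_iff.1 he.central
  set Φ := MonoidAlgebra.mapDomainAlgHom k k ι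
  have hef : e * Φ f = e := he.mul_map_eq hf hι hn
  let ψ := BlockAlgebra.mapAlgHom he.toIsBlockIdempotent hf.toIsBlockIdempotent Φ hef
  have hbij : Function.Bijective ψ := by
    constructor
    · rw [injective_iff_map_eq_zero]
      intro a ha
      refine Subtype.ext (eq_zero_of_map_mul_eq_zero p he hf hι hex hQ hcl
        (BlockAlgebra.mul_right _ a) ?_)
      rw [hec]
      exact congrArg Subtype.val ha
    · intro b
      have hb := mul_mem_mapMulRange_of_forall p he hex hQ hcl b.1
      obtain ⟨y, hy⟩ := mem_mapMulRange.1 hb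
      rw [BlockAlgebra.mul_right] at hy
      refine ⟨BlockAlgebra.proj hf.toIsBlockIdempotent y, Subtype.ext ?_⟩
      change e * Φ (f * y) = b.1
      rw [map_mul, ← mul_assoc, hef, ← hec, hy]
  have hψι : ∀ h, ψ (toBlockAlgebra hf.toIsBlockIdempotent h) =
      toBlockAlgebra he.toIsBlockIdempotent (ι h) := fun h => Subtype.ext <| by
    have hΦ : Φ (MonoidAlgebra.of k H h) = MonoidAlgebra.of k G (ι h) := by simp [Φ]
    have : e * Φ (f * MonoidAlgebra.of k H h) = e * MonoidAlgebra.of k G (ι h) := by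
      rw [map_mul, ← mul_assoc, hef, hΦ]
    exact this
  exact SplendidlyMoritaEquivalent.of_algEquiv _ _ ι (AlgEquiv.ofBijective ψ hbij) hψι

end SplendidIso

/-! ### Indices of subgroups -/

/-- The product formula: `|SN : S| = |N : S ∩ N|` for `N` normal. -/
theorem Subgroup.relIndex_sup_eq_relIndex {G : Type*} [Group G] [Finite G] (S N : Subgroup G)
    [N.Normal] : S.relIndex (S ⊔ N) = S.relIndex N := by
  have h1 := Subgroup.relIndex_mul_relIndex ⊥ (S ⊓ N) N bot_le inf_le_right
  have h2 := Subgroup.relIndex_mul_relIndex ⊥ (S ⊓ N) S bot_le inf_le_left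
  have h3 := Subgroup.relIndex_mul_relIndex ⊥ N (S ⊔ N) bot_le le_sup_right
  have h4 := Subgroup.relIndex_mul_relIndex ⊥ S (S ⊔ N) bot_le le_sup_left
  rw [Subgroup.inf_relIndex_right] at h1
  rw [Subgroup.inf_relIndex_left] at h2
  rw [Subgroup.relIndex_sup_right, ← h4, ← h1, ← h2] at h3
  have hd : (⊥ : Subgroup G).relIndex (S ⊓ N) ≠ 0 := by
    rw [Subgroup.relIndex_bot_left]; exact Nat.card_pos.ne'
  have hb : N.relIndex S ≠ 0 :=
    (Nat.pos_of_dvd_of_pos (N.relIndex_dvd_card S) Nat.card_pos).ne'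
  refine (Nat.eq_of_mul_eq_mul_left (Nat.pos_of_ne_zero (mul_ne_zero hd hb)) ?_).symm
  rw [← h3]; ring

theorem Subgroup.relIndex_dvd_index_of_normal_right {G : Type*} [Group G] [Finite G]
    (S N : Subgroup G) [N.Normal] : S.relIndex N ∣ S.index := by
  rw [← Subgroup.relIndex_sup_eq_relIndex]
  exact Subgroup.relIndex_dvd_index_of_le le_sup_left

/-- In `N ⋊ C` with `C` commutative, the class size of `c ∈ C` is the index in `N` of the fixed
points of `c`, so it divides the index of every subgroup that `c` fixes pointwise. -/
theorem SemidirectProduct.index_centralizer_inr_dvd {N C : Type*} [Group N] [CommGroup C]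
    [Finite N] [Finite C] (θ : C →* MulAut N) (c : C) (K : Subgroup N)
    (hK : ∀ h ∈ K, θ c h = h) :
    (Subgroup.centralizer {(SemidirectProduct.inr c : N ⋊[θ] C)}).index ∣ K.index := by
  have : Finite (N ⋊[θ] C) := Finite.of_equiv _ SemidirectProduct.equivProd.symm
  set S := Subgroup.centralizer {(SemidirectProduct.inr c : N ⋊[θ] C)} with hS
  have hn : (SemidirectProduct.inl : N →* N ⋊[θ] C).range.Normal := by
    rw [SemidirectProduct.range_inl_eq_ker_rightHom]; infer_instance
  have htop : S ⊔ (SemidirectProduct.inl : N →* N ⋊[θ] C).range = ⊤ := by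
    rw [eq_top_iff]
    intro x _
    rw [← SemidirectProduct.inl_left_mul_inr_right x]
    refine mul_mem (Subgroup.mem_sup_right ⟨_, rfl⟩) (Subgroup.mem_sup_left ?_)
    rw [hS, Subgroup.mem_centralizer_singleton_iff, ← map_mul, ← map_mul, mul_comm]
  have hidx : (S.comap (SemidirectProduct.inl : N →* N ⋊[θ] C)).index = S.index := by
    rw [Subgroup.index_comap, ← Subgroup.relIndex_sup_eq_relIndex, htop,
      Subgroup.relIndex_top_right]
  rw [← hidx]
  refine Subgroup.index_dvd_of_le fun h hh => ?_
  rw [Subgroup.mem_comap, hS, Subgroup.mem_centralizer_singleton_iff]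
  ext
  · simp [hK h hh]
  · simp

/-! ### Fixed points of field automorphisms of odd order -/

theorem odd_geom_sum {a n : ℕ} (ha : Odd a) (hn : Odd n) : Odd (∑ i ∈ Finset.range n, a ^ i) := by
  rw [Finset.odd_sum_iff_odd_card_odd, Finset.filter_true_of_mem fun i _ => ha.pow,
    Finset.card_range]
  exact hn

theorem natCard_GL_two (K : Type*) [Field K] [Finite K] :
    Nat.card (GL (Fin 2) K) =
      (Nat.card K ^ 2 - 1) * (Nat.card K * (Nat.card K - 1)) := by
  have := Fintype.ofFinite K
  rw [Matrix.card_GL_field, Fin.prod_univ_two, ← Nat.card_eq_fintype_card, Nat.mul_sub_one]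
  simp [sq]

/-- In odd characteristic and for an extension `K / K₀` of odd degree, `GL₂(K₀)` has odd index in
`GL₂(K)`. -/
theorem odd_index_range_GL_map (K₀ K : Type*) [Field K₀] [Field K] [Finite K] [Algebra K₀ K]
    (hK : Odd (Nat.card K)) (hn : Odd (Module.finrank K₀ K)) :
    Odd (Matrix.GeneralLinearGroup.map (n := Fin 2) (algebraMap K₀ K)).range.index := by
  have : Finite K₀ := Finite.of_injective _ (algebraMap K₀ K).injective
  set n := Module.finrank K₀ K
  have hq : Nat.card K = Nat.card K₀ ^ n := Module.natCard_eq_pow_finrank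
  have hinj : Function.Injective (Matrix.GeneralLinearGroup.map (n := Fin 2) (algebraMap K₀ K)) :=
    Units.map_injective (Matrix.map_injective (algebraMap K₀ K).injective)
  have hcard := (Matrix.GeneralLinearGroup.map (n := Fin 2) (algebraMap K₀ K)).range.card_mul_index
  rw [← Nat.card_congr (MonoidHom.ofInjective hinj).toEquiv, natCard_GL_two, natCard_GL_two,
    hq] at hcard
  have hq₀ : Odd (Nat.card K₀) := by
    rw [hq] at hK
    exact (Nat.odd_pow_iff hn.pos.ne').1 hK
  have hq1 : 1 < Nat.card K₀ := Finite.one_lt_card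
  generalize Nat.card K₀ = a at *
  have hgeom : ∀ b : ℕ, 1 ≤ b → b ^ n - 1 = (∑ i ∈ Finset.range n, b ^ i) * (b - 1) := by
    intro b hb
    obtain ⟨x, rfl⟩ := Nat.exists_eq_add_of_le' hb
    rw [← geom_sum_mul_add, Nat.add_sub_cancel, Nat.add_sub_cancel]
  obtain ⟨l, hl⟩ : ∃ l, n = l + 1 := ⟨_, (Nat.sub_add_cancel hn.pos).symm⟩
  have ha2 : 1 < a ^ 2 := Nat.one_lt_pow two_ne_zero hq1
  have hpos : 0 < (a ^ 2 - 1) * (a * (a - 1)) :=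
    Nat.mul_pos (by omega) (Nat.mul_pos (by omega) (by omega))
  have hfac : ((a ^ n) ^ 2 - 1) * (a ^ n * (a ^ n - 1)) = (a ^ 2 - 1) * (a * (a - 1)) *
      ((∑ i ∈ Finset.range n, (a ^ 2) ^ i) * (a ^ l * ∑ i ∈ Finset.range n, a ^ i)) := by
    rw [← pow_mul, mul_comm n 2, pow_mul, hgeom _ ha2.le, hgeom a hq1.le]
    have : a ^ n = a ^ l * a := by rw [hl, pow_succ]
    rw [this]; ring
  rw [hfac] at hcard
  rw [Nat.eq_of_mul_eq_mul_left hpos hcard]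
  exact (odd_geom_sum hq₀.pow hn).mul (hq₀.pow.mul (odd_geom_sum hq₀ hn))

section FixedPoints

variable {F : Type v} [Field F]

/-- The elements of `GL₂(F)` whose entries are fixed by `σ`. -/
def fixedGL (σ : RingAut F) : Subgroup (GL (Fin 2) F) :=
  (Matrix.GeneralLinearGroup.map (σ : F →+* F)).eqLocus (MonoidHom.id _)

theorem odd_index_fixedGL [Finite F] (hF : Odd (Nat.card F)) {σ : RingAut F}
    (hσ : Odd (orderOf σ)) : Odd (fixedGL σ).index := by
  let F₀ := FixedPoints.subfield (Subgroup.zpowers σ) F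
  have hn : Odd (Module.finrank F₀ F) := by
    have := Fintype.ofFinite (Subgroup.zpowers σ)
    rw [FixedPoints.finrank_eq_card, ← Nat.card_eq_fintype_card, Nat.card_zpowers]
    exact hσ
  refine (odd_index_range_GL_map F₀ F hF hn).of_dvd_nat (Subgroup.index_dvd_of_le ?_)
  rintro _ ⟨A, rfl⟩
  refine Matrix.GeneralLinearGroup.ext fun i j => ?_
  exact (A i j).2 ⟨σ, Subgroup.mem_zpowers σ⟩

theorem odd_index_fixedGL_comap_toGL [Finite F] (hF : Odd (Nat.card F)) {σ : RingAut F}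
    (hσ : Odd (orderOf σ)) :
    Odd ((fixedGL σ).comap
      (Matrix.SpecialLinearGroup.toGL : Matrix.SpecialLinearGroup (Fin 2) F →* _)).index := by
  have hr : (Matrix.SpecialLinearGroup.toGL : Matrix.SpecialLinearGroup (Fin 2) F →* _).range =
      (Matrix.GeneralLinearGroup.det : GL (Fin 2) F →* Fˣ).ker := by
    ext A
    constructor
    · rintro ⟨B, rfl⟩
      exact Units.ext B.2
    · intro hA
      exact ⟨⟨A.1, congrArg Units.val hA⟩, Units.ext rfl⟩
  rw [Subgroup.index_comap, hr]
  exact (odd_index_fixedGL hF hσ).of_dvd_nat (Subgroup.relIndex_dvd_index_of_normal_right _ _)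

end FixedPoints

/-! ### Semidirect products with field automorphisms -/

/-- `N ⋊ C` and `N` have splendidly Morita equivalent principal blocks if `C` is commutative of
order prime to `p` and every element of `C` fixes a subgroup of `N` of index prime to `p`. -/
theorem principalBlocksSplendidlyMoritaEquivalent_semidirectProduct {k : Type u} [Field k]
    (p : ℕ) [Fact p.Prime] [CharP k p] {N C : Type v} [Group N] [Group C] [Finite N] [Finite C]
    (hcomm : ∀ a b : C, a * b = b * a) (θ : C →* MulAut N) [Finite (N ⋊[θ] C)]
    (hC : ¬ p ∣ Nat.card C)
    (hK : ∀ c, ∃ K : Subgroup N, ¬ p ∣ K.index ∧ ∀ h ∈ K, θ c h = h) :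
    PrincipalBlocksSplendidlyMoritaEquivalent k (N ⋊[θ] C) N := by
  let _ : CommGroup C := { (inferInstance : Group C) with mul_comm := hcomm }
  refine IsPrincipalBlockIdempotent.splendidlyMoritaEquivalent p
    (principalBlockIdempotent_spec k _) (principalBlockIdempotent_spec k _)
    (SemidirectProduct.inl_injective (φ := θ)) (φ := SemidirectProduct.rightHom)
    SemidirectProduct.range_inl_eq_ker_rightHom hC fun c => ?_
  obtain ⟨K, hKp, hKc⟩ := hK c
  exact ⟨SemidirectProduct.inr c, SemidirectProduct.rightHom_inr c, fun h =>
    hKp (h.trans (SemidirectProduct.index_centralizer_inr_dvd θ c K hKc))⟩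

/-- The automorphism group of a finite field is the Galois group over the prime field, which is
cyclic. -/
theorem ringAut_mul_comm {F : Type*} [Field F] [Finite F] (σ τ : RingAut F) : σ * τ = τ * σ := by
  obtain ⟨p, _⟩ := CharP.exists F
  have : Fact p.Prime := ⟨CharP.char_is_prime F p⟩
  let _ : Algebra (ZMod p) F := ZMod.algebra F p
  have hc : ∀ τ : RingAut F, ∀ a : ZMod p, τ (algebraMap (ZMod p) F a) = algebraMap (ZMod p) F a :=
    fun τ a => RingHom.congr_fun
      (Subsingleton.elim ((τ : F →+* F).comp (algebraMap (ZMod p) F)) (algebraMap (ZMod p) F)) a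
  have h := mul_comm' (AlgEquiv.ofRingEquiv (f := σ) (hc σ) : Gal(F/ZMod p))
    (AlgEquiv.ofRingEquiv (f := τ) (hc τ))
  exact RingEquiv.ext fun x => DFunLike.congr_fun h x

/-- `F` is the field with `q` elements, `q` odd; `C` is a group of odd order of automorphisms of
`F` (it is automatically cyclic). -/
theorem corollary6p2 {k : Type u} [Field k] [IsAlgClosed k] [CharP k 2]
    (F : Type v) [Field F] [Finite F] (hF : Odd (Nat.card F))
    (C : Subgroup (RingAut F)) (hC : Odd (Nat.card C)) :
    (HasDihedralSylowTwo PSL(2, F) →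
      PrincipalBlocksSplendidlyMoritaEquivalent k (PSLSemidirect F C) PSL(2, F)) ∧
    (HasDihedralSylowTwo PGL(2, F) →
      PrincipalBlocksSplendidlyMoritaEquivalent k (PGLSemidirect F C) PGL(2, F)) := by
  have hcomm : ∀ σ τ : C, σ * τ = τ * σ := fun σ τ => Subtype.ext (ringAut_mul_comm σ.1 τ.1)
  have hC' : ¬ 2 ∣ Nat.card C := hC.not_two_dvd_nat
  have hord : ∀ σ : C, Odd (orderOf (σ : RingAut F)) := fun σ =>
    hC.of_dvd_nat (Subgroup.orderOf_dvd_natCard C σ.2)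
  constructor
  · intro _
    refine principalBlocksSplendidlyMoritaEquivalent_semidirectProduct 2 hcomm _ hC' fun σ =>
      ⟨((fixedGL (σ : RingAut F)).comap Matrix.SpecialLinearGroup.toGL).map
        (QuotientGroup.mk' _), ?_, ?_⟩
    · exact ((odd_index_fixedGL_comap_toGL hF (hord σ)).of_dvd_nat
        (Subgroup.index_map_dvd _ (QuotientGroup.mk'_surjective _))).not_two_dvd_nat
    · rintro _ ⟨A, hA, rfl⟩
      have hfix : slFieldAut F σ A = A := by
        ext i j
        exact congrArg (fun B : GL (Fin 2) F => B i j) hA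
      exact congrArg (QuotientGroup.mk' _) hfix
  · intro _
    refine principalBlocksSplendidlyMoritaEquivalent_semidirectProduct 2 hcomm _ hC' fun σ =>
      ⟨(fixedGL (σ : RingAut F)).map Matrix.ProjGenLinGroup.mk, ?_, ?_⟩
    · exact ((odd_index_fixedGL hF (hord σ)).of_dvd_nat
        (Subgroup.index_map_dvd _ Matrix.ProjGenLinGroup.mk_surjective)).not_two_dvd_nat
    · rintro _ ⟨A, hA, rfl⟩
      exact congrArg Matrix.ProjGenLinGroup.mk hA
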